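/- For integers $n\ge 0$ and $k\ge 0$, let $d_{n,k}$ be the number of permutations $\sigma$ of $[n]=\{1,\dots,n\}$ such that $\sigma(i)\ne i$ for all $i\in[n]$ (derangements) and such that there are exactly $k$ indices $i\in[n]$ with $\sigma(i)<\sigma(j)$ for all $j>i$ (right-to-left minima). Then, as an identity of formal power series in $t$, $$\sum_{n\ge 0} d_{n+2,1}\,t^n=\cfrac{1}{1-\gamma_0 t-\cfrac{\beta_1 t^2}{1-\gamma_1 t-\cfrac{\beta_2 t^2}{1-\gamma_2 t-\cdots}}}=\cfrac{1}{1-t-\cfrac{2t^2}{1-3t-\cfrac{6t^2}{1-5t-\cdots}}},$$ where $\gamma_n=2n+1$ for $n\ge 0$ (so $\gamma_0=1$) and $\beta_n=n(n+1)$ for $n\ge 1$. The infinite continued fraction (J-fraction) denotes the coefficientwise limit, as $k\to\infty$, of the finite fractions obtained by stopping at the denominator $1-\gamma_k t$. -/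

import Mathlib

open PowerSeries

/-- The number of right-to-left minima of a permutation of `Fin n`:
the positions `i` such that `σ i < σ j` for all `j > i`. -/
def rlm {n : ℕ} (σ : Equiv.Perm (Fin n)) : ℕ :=
  (Finset.univ.filter fun i : Fin n => ∀ j : Fin n, i < j → σ i < σ j).card

/-- `derangementRlm n k` is the number of derangements of an `n`-element chain with exactly
`k` right-to-left minima. -/
def derangementRlm (n k : ℕ) : ℕ :=
  (Finset.univ.filter fun σ : Equiv.Perm (Fin n) => (∀ i, σ i ≠ i) ∧ rlm σ = k).card

/-- The finite J-fraction with rows `m, m + 1, …, m + k`: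
`1 / (1 - γ_m X - β_{m+1} X ^ 2 / (1 - γ_{m+1} X - … - β_{m+k} X ^ 2 / (1 - γ_{m+k} X)))`.
All denominators have constant coefficient `1`, and `invOfUnit _ 1` is their inverse. -/
noncomputable def jConvergent {R : Type*} [CommRing R] (γ β : ℕ → R) : ℕ → ℕ → R⟦X⟧
  | 0, m => invOfUnit (1 - C (γ m) * X) 1
  | k + 1, m =>
      invOfUnit (1 - C (γ m) * X - C (β (m + 1)) * X ^ 2 * jConvergent γ β k (m + 1)) 1

theorem jConvergent_zero_mul {R : Type*} [CommRing R] (γ β : ℕ → R) (m : ℕ) :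
    (1 - C (γ m) * X) * jConvergent γ β 0 m = 1 := by
  rw [jConvergent]
  exact mul_invOfUnit _ _ (by simp)

theorem jConvergent_succ_mul {R : Type*} [CommRing R] (γ β : ℕ → R) (k m : ℕ) :
    (1 - C (γ m) * X - C (β (m + 1)) * X ^ 2 * jConvergent γ β k (m + 1)) *
      jConvergent γ β (k + 1) m = 1 := by
  rw [jConvergent]
  exact mul_invOfUnit _ _ (by simp)

/-- The formal power series `f` is the value of the infinite J-fraction
`1 / (1 - γ_0 X - β_1 X ^ 2 / (1 - γ_1 X - β_2 X ^ 2 / (1 - …)))`, i.e. the formal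
(coefficientwise) limit of its finite truncations: every coefficient is eventually constant,
equal to that of `f`. -/
def HasJFraction {R : Type*} [CommRing R] (f : R⟦X⟧) (γ β : ℕ → R) : Prop :=
  ∀ n : ℕ, ∀ᶠ k in Filter.atTop, coeff n (jConvergent γ β k 0) = coeff n f

/-! By conjugation symmetry the derangements counted form a fraction `1/(n+1)` of all `D_{n+2}`, so
there are `D_n + D_{n+1}` of them. This is the `n`-th difference at `0` of `j ↦ (j+1)!`. The numbers
`(n+1)!` are the Laguerre moments with `γ_m = 2m+2`, `β_m = m(m+1)`, by a closed form for their
Stieltjes matrix. Taking differences only lowers each `γ_m` by one (`IsStieltjesMatrix.fwdDiff`). -/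

/-- The tails of a J-fraction with parameters `γ, β` approximate the quotients `h (m + 1) / h m`
of any sequence satisfying the corresponding three-term recurrence. -/
theorem X_pow_dvd_sub_jConvergent_mul {R : Type*} [CommRing R] {γ β : ℕ → R} {h : ℕ → R⟦X⟧}
    (hh : ∀ m, h m = (1 - C (γ m) * X) * h (m + 1) - C (β (m + 1)) * X ^ 2 * h (m + 2))
    (k m : ℕ) : X ^ (2 * k + 2) ∣ h (m + 1) - jConvergent γ β k m * h m := by
  induction k generalizing m with
  | zero =>
    refine ⟨jConvergent γ β 0 m * C (β (m + 1)) * h (m + 2), ?_⟩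
    linear_combination (-jConvergent γ β 0 m) * hh m - h (m + 1) * jConvergent_zero_mul γ β m
  | succ k ih =>
    obtain ⟨q, hq⟩ := ih (m + 1)
    refine ⟨jConvergent γ β (k + 1) m * C (β (m + 1)) * q, ?_⟩
    linear_combination (-jConvergent γ β (k + 1) m) * hh m
      - h (m + 1) * jConvergent_succ_mul γ β k m
      + jConvergent γ β (k + 1) m * C (β (m + 1)) * X ^ 2 * hq

/-- `M` is the Stieltjes matrix of the J-fraction with parameters `γ, β`: the entry `M n m` is the
weighted count of Motzkin paths of length `n` from height `0` to height `m`. -/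
structure IsStieltjesMatrix {R : Type*} [CommRing R] (γ β : ℕ → R) (M : ℕ → ℕ → R) : Prop where
  zero_zero : M 0 0 = 1
  zero_succ : ∀ m, M 0 (m + 1) = 0
  succ_zero : ∀ n, M (n + 1) 0 = γ 0 * M n 0 + β 1 * M n 1
  succ_succ : ∀ n m, M (n + 1) (m + 1) =
    M n m + γ (m + 1) * M n (m + 1) + β (m + 2) * M n (m + 2)

namespace IsStieltjesMatrix

variable {R : Type*} [CommRing R] {γ β : ℕ → R} {M : ℕ → ℕ → R}

theorem eq_zero_of_lt (hM : IsStieltjesMatrix γ β M) {n m : ℕ} (h : n < m) : M n m = 0 := by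
  induction n generalizing m with
  | zero =>
    obtain ⟨m, rfl⟩ := Nat.exists_eq_succ_of_ne_zero h.ne'
    exact hM.zero_succ m
  | succ n ih =>
    obtain ⟨m, rfl⟩ := Nat.exists_eq_succ_of_ne_zero (Nat.ne_zero_of_lt h)
    rw [Nat.succ_eq_add_one, hM.succ_succ, ih (by omega), ih (by omega), ih (by omega)]
    simp

theorem hasJFraction (hM : IsStieltjesMatrix γ β M) :
    HasJFraction (PowerSeries.mk fun n => M n 0) γ β := by
  -- Column `m` has generating function `X^m * h (m + 1)`; the extra term `h 0 = 1` makes `h 1 / h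
  -- 0` column `0`.
  let h : ℕ → R⟦X⟧ := fun m => Nat.casesOn m 1 fun m => PowerSeries.mk fun n => M (n + m) m
  have hh (m : ℕ) :
      h m = (1 - C (γ m) * X) * h (m + 1) - C (β (m + 1)) * X ^ 2 * h (m + 2) := by
    ext n
    rw [sub_mul, one_mul, mul_assoc, mul_assoc, map_sub, map_sub, coeff_C_mul, coeff_C_mul]
    rcases m with _ | m <;> rcases n with _ | _ | n
    · simp [h, hM.zero_zero]
    · simp [h, coeff_X_pow_mul', coeff_one, coeff_succ_X_mul, hM.succ_zero, hM.zero_zero,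
        hM.zero_succ]
    · rw [show h (0 + 2) = PowerSeries.mk fun n => M (n + 1) 1 from rfl]
      simp [h, coeff_X_pow_mul', coeff_one, coeff_succ_X_mul, hM.succ_zero (n + 1)]
    · simp [h, hM.succ_succ, hM.eq_zero_of_lt]
    · have := hM.succ_succ (m + 1) m
      rw [hM.eq_zero_of_lt (show m + 1 < m + 2 by omega)] at this
      simp only [h, zero_add, coeff_mk, coeff_succ_X_mul, coeff_X_pow_mul']
      rw [if_neg (by omega), show 1 + m = m + 1 by ring, show 1 + (m + 1) = m + 1 + 1 by ring, this]
      ring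
    · have := hM.succ_succ (n + 1 + 1 + m) m
      simp only [h, coeff_mk, coeff_succ_X_mul, coeff_X_pow_mul']
      rw [if_pos (by omega), show n + 1 + 1 + (m + 1) = n + 1 + 1 + m + 1 by ring,
        show n + 1 + (m + 1) = n + 1 + 1 + m by ring,
        show n + 1 + 1 - 2 + (m + 1 + 1) = n + 1 + 1 + m by omega, this]
      ring
  intro n
  filter_upwards [Filter.eventually_ge_atTop n] with k hk
  have key := X_pow_dvd_iff.mp (X_pow_dvd_sub_jConvergent_mul hh k 0) n (by omega)
  rw [show h 0 = 1 from rfl, mul_one, map_sub] at key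
  exact (sub_eq_zero.mp key).symm

/-- Taking differences of the columns of a Stieltjes matrix lowers the parameters `γ` by one. -/
theorem fwdDiff (hM : IsStieltjesMatrix γ β M) :
    IsStieltjesMatrix (fun m => γ m - 1) β
      (fun n m => (_root_.fwdDiff 1)^[n] (fun j => M j m) 0) where
  zero_zero := hM.zero_zero
  zero_succ := hM.zero_succ
  succ_zero n := by
    -- The difference is the row shift minus the identity, so only the diagonal term changes.
    have e : _root_.fwdDiff 1 (fun j => M j 0) =
        (γ 0 - 1) • (fun j => M j 0) + β 1 • fun j => M j 1 := by
      funext j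
      simp only [_root_.fwdDiff, hM.succ_zero, Pi.add_apply, Pi.smul_apply, smul_eq_mul]
      ring
    rw [Function.iterate_succ_apply, e, fwdDiff_iter_add, fwdDiff_iter_const_smul,
      fwdDiff_iter_const_smul]
    rfl
  succ_succ n m := by
    have e : _root_.fwdDiff 1 (fun j => M j (m + 1)) =
        (fun j => M j m) + (γ (m + 1) - 1) • (fun j => M j (m + 1)) +
          β (m + 2) • fun j => M j (m + 2) := by
      funext j
      simp only [_root_.fwdDiff, hM.succ_succ, Pi.add_apply, Pi.smul_apply, smul_eq_mul]
      ring
    rw [Function.iterate_succ_apply, e, fwdDiff_iter_add, fwdDiff_iter_add,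
      fwdDiff_iter_const_smul, fwdDiff_iter_const_smul]
    rfl

end IsStieltjesMatrix

/-- The Stieltjes matrix of the moments `(n + 1)!` of the Laguerre polynomials with `α = 1`. -/
def laguerreStieltjes : ℕ → ℕ → ℤ
  | 0, 0 => 1
  | 0, _ + 1 => 0
  | n + 1, 0 => 2 * laguerreStieltjes n 0 + 2 * laguerreStieltjes n 1
  | n + 1, m + 1 => laguerreStieltjes n m + (2 * ((m : ℤ) + 1) + 2) * laguerreStieltjes n (m + 1)
      + ((m : ℤ) + 2) * ((m : ℤ) + 3) * laguerreStieltjes n (m + 2)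

theorem isStieltjesMatrix_laguerreStieltjes :
    IsStieltjesMatrix (fun m : ℕ => 2 * (m : ℤ) + 2) (fun m : ℕ => (m : ℤ) * ((m : ℤ) + 1))
      laguerreStieltjes where
  zero_zero := by rw [laguerreStieltjes]
  zero_succ m := by rw [laguerreStieltjes]
  succ_zero n := by rw [laguerreStieltjes]; norm_num
  succ_succ n m := by rw [laguerreStieltjes]; push_cast; ring

theorem factorial_mul_laguerreStieltjes (n m : ℕ) :
    ((m + 1).factorial : ℤ) * laguerreStieltjes n m = n.choose m * (n + 1).factorial := by
  induction n generalizing m with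
  | zero => cases m <;> simp [laguerreStieltjes]
  | succ n ih =>
    cases m with
    | zero =>
      have h0 := ih 0
      have h1 := ih 1
      rw [laguerreStieltjes]
      simp only [Nat.factorial_succ, Nat.choose_zero_right, Nat.choose_one_right] at *
      push_cast at *
      linear_combination 2 * h0 + h1
    | succ m =>
      have h0 := ih m
      have h1 := ih (m + 1)
      have h2 := ih (m + 2)
      have c1 : (n + 1).choose (m + 1) = n.choose m + n.choose (m + 1) := Nat.choose_succ_succ ..
      have c2 : (n + 1).choose (m + 2) = n.choose (m + 1) + n.choose (m + 2) :=
        Nat.choose_succ_succ ..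
      -- Absorption identity `(n+2) C(n+1,m+1) = (m+2) C(n+2,m+2)`, expanded by Pascal's rule.
      have c3 : (n + 2) * (n + 1).choose (m + 1) =
          ((n + 1).choose (m + 1) + (n + 1).choose (m + 2)) * (m + 2) := by
        rw [← Nat.choose_succ_succ]
        exact Nat.add_one_mul_choose_eq (n + 1) (m + 1)
      rw [laguerreStieltjes]
      rw [c1, c2] at c3
      rw [c1]
      zify at c3
      simp only [Nat.factorial_succ] at *
      push_cast at *
      linear_combination ((m : ℤ) + 2) * h0 + 2 * ((m : ℤ) + 2) * h1 + ((m : ℤ) + 2) * h2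
        - ((n : ℤ) + 1) * n.factorial * c3

theorem laguerreStieltjes_zero (n : ℕ) : laguerreStieltjes n 0 = (n + 1).factorial := by
  simpa using factorial_mul_laguerreStieltjes n 0

/-- Both sides are the inclusion–exclusion sum of `(-1)^k n!/k!`. -/
theorem fwdDiff_iter_factorial (n : ℕ) :
    (fwdDiff 1)^[n] (fun j : ℕ => (j.factorial : ℤ)) 0 = numDerangements n := by
  rw [fwdDiff_iter_eq_sum_shift, numDerangements_sum, ← Finset.sum_range_reflect]
  refine Finset.sum_congr rfl fun k hk => ?_
  have hk : k ≤ n := Nat.lt_succ_iff.mp (Finset.mem_range.mp hk)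
  rw [show n + 1 - 1 - k = n - k by omega, Nat.sub_sub_self hk]
  have e : n.choose (n - k) * (n - k).factorial = (k + 1).ascFactorial (n - k) := by
    have := Nat.choose_mul_factorial_mul_factorial (Nat.sub_le n k)
    have h2 := Nat.factorial_mul_ascFactorial k (n - k)
    rw [Nat.sub_sub_self hk] at this
    rw [Nat.add_sub_cancel' hk] at h2
    exact Nat.eq_of_mul_eq_mul_right k.factorial_pos (by linarith)
  simp [← e, mul_assoc]

theorem fwdDiff_iter_factorial_succ (n : ℕ) :
    (fwdDiff 1)^[n] (fun j : ℕ => ((j + 1).factorial : ℤ)) 0 =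
      numDerangements n + numDerangements (n + 1) := by
  have e : (fun j : ℕ => ((j + 1).factorial : ℤ)) =
      (fun j : ℕ => (j.factorial : ℤ)) + fwdDiff 1 fun j : ℕ => (j.factorial : ℤ) := by
    funext j
    simp [fwdDiff]
  rw [e, fwdDiff_iter_add, Pi.add_apply, ← Function.iterate_succ_apply, fwdDiff_iter_factorial,
    fwdDiff_iter_factorial]

/-- The last position and the position of the value `0` are always right-to-left minima; if they
coincide, `0` at the end rules out all others. -/
theorem rlm_eq_one_iff {n : ℕ} (σ : Equiv.Perm (Fin (n + 1))) :
    rlm σ = 1 ↔ σ (Fin.last n) = 0 := by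
  have last_mem : Fin.last n ∈ Finset.univ.filter
      fun i : Fin (n + 1) => ∀ j : Fin (n + 1), i < j → σ i < σ j := by
    simp only [Finset.mem_filter, Finset.mem_univ, true_and]
    exact fun j hj => absurd hj (Fin.le_last j).not_gt
  constructor
  · intro h
    have inv_mem : σ.symm 0 ∈ Finset.univ.filter
        fun i : Fin (n + 1) => ∀ j : Fin (n + 1), i < j → σ i < σ j := by
      simp only [Finset.mem_filter, Finset.mem_univ, true_and, Equiv.apply_symm_apply]
      refine fun j hj => Fin.pos_of_ne_zero fun h0 => hj.ne ?_
      rw [← h0, Equiv.symm_apply_apply]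
    rw [Finset.card_le_one_iff.mp h.le last_mem inv_mem, Equiv.apply_symm_apply]
  · intro h
    refine Finset.card_eq_one.mpr ⟨Fin.last n, Finset.eq_singleton_iff_unique_mem.mpr
      ⟨last_mem, fun i hi => by_contra fun hne => ?_⟩⟩
    have := (Finset.mem_filter.mp hi).2 _ (Fin.lt_last_iff_ne_last.mpr hne)
    rw [h] at this
    exact Fin.not_lt_zero _ this

/-- Conjugation by a transposition shows that the number of derangements sending `a` to `b ≠ a`
does not depend on `b`. -/
theorem card_derangements_apply_eq {α : Type*} [Fintype α] [DecidableEq α] {a b c : α}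
    (hb : b ≠ a) (hc : c ≠ a) :
    (Finset.univ.filter fun σ : Equiv.Perm α => (∀ i, σ i ≠ i) ∧ σ a = b).card =
      (Finset.univ.filter fun σ : Equiv.Perm α => (∀ i, σ i ≠ i) ∧ σ a = c).card := by
  refine Finset.card_equiv (MulAut.conj (Equiv.swap b c)).toEquiv fun σ => ?_
  have ha : Equiv.swap b c a = a := Equiv.swap_apply_of_ne_of_ne hb.symm hc.symm
  simp only [Finset.mem_filter, Finset.mem_univ, true_and, MulEquiv.toEquiv_eq_coe,
    MulEquiv.coe_toEquiv, MulAut.conj_apply, Equiv.swap_inv, Equiv.Perm.mul_apply, ha]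
  refine and_congr ?_ ?_
  · rw [← (Equiv.swap b c).forall_congr_right]
    exact forall_congr' fun i => not_congr (Equiv.swap_apply_eq_iff ..).symm
  · rw [Equiv.swap_apply_eq_iff, Equiv.swap_apply_right]

/-- The `n + 1` possible images of the last point are equally frequent, and `D_{n+2} = (n+1)(D_n +
D_{n+1})`. -/
theorem derangementRlm_one (n : ℕ) :
    derangementRlm (n + 2) 1 = numDerangements n + numDerangements (n + 1) := by
  set s : Finset (Equiv.Perm (Fin (n + 2))) := Finset.univ.filter fun σ => ∀ i, σ i ≠ i with hs
  have hcard : s.card = numDerangements (n + 2) := by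
    rw [← card_derangements_fin_eq_numDerangements, ← Fintype.card_coe]
    exact Fintype.card_congr (Equiv.subtypeEquivRight fun σ => by simp [hs, derangements])
  have hfib : ∀ b ∈ Finset.univ.erase (Fin.last (n + 1)),
      (s.filter fun σ => σ (Fin.last (n + 1)) = b).card = derangementRlm (n + 2) 1 := by
    intro b hb
    simp only [derangementRlm, rlm_eq_one_iff, hs, Finset.filter_filter]
    convert card_derangements_apply_eq (Finset.ne_of_mem_erase hb) Fin.last_pos.ne
  have hmaps : ∀ σ ∈ s, σ (Fin.last (n + 1)) ∈ Finset.univ.erase (Fin.last (n + 1)) := by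
    intro σ hσ
    simpa using (Finset.mem_filter.mp hσ).2 _
  have := Finset.card_eq_sum_card_fiberwise hmaps
  rw [Finset.sum_congr rfl hfib, Finset.sum_const, hcard, numDerangements_add_two,
    Finset.card_erase_of_mem (Finset.mem_univ _), Finset.card_univ, Fintype.card_fin,
    smul_eq_mul] at this
  exact (Nat.eq_of_mul_eq_mul_left n.succ_pos this).symm

theorem corollary3p1 :
    HasJFraction (R := ℤ)
      (PowerSeries.mk fun n : ℕ => (derangementRlm (n + 2) 1 : ℤ))
      (fun n : ℕ => 2 * (n : ℤ) + 1)
      (fun n : ℕ => (n : ℤ) * ((n : ℤ) + 1)) := by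
  have h := isStieltjesMatrix_laguerreStieltjes.fwdDiff.hasJFraction
  simp only [laguerreStieltjes_zero, fwdDiff_iter_factorial_succ, add_sub_assoc] at h
  simpa only [derangementRlm_one, Nat.cast_add, show (2 : ℤ) - 1 = 1 from rfl] using h
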